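/- Let $\mathcal G=(Q,A,\sigma,\gamma)$ be a finite directed graph: $Q$ (vertices) and $A$ (arrows) are finite sets and $\sigma,\gamma:A\to Q$ are the source and target maps. Let $W$ be the language of paths of $\mathcal G$, that is, the set of words $a_1\cdots a_n$ ($n\ge 0$, $a_k\in A$) with $\gamma(a_k)=\sigma(a_{k+1})$ for $1\le k\le n-1$. Assume that $\mathcal G$ is connected, that is, for all $q,q'\in Q$ there is a path from $q$ to $q'$ (the empty path being allowed if $q=q'$). Equip $\mathcal E=\mathbb R^A$ with the standard inner product and norm. For a word $w$ let $\mathscr P(w)\in\mathcal E$ be the vector whose coordinate at $a\in A$ is the number of occurrences of $a$ in $w$, and let $\nu=\sum_{w\in W}\delta_{\mathscr P(w)}$. For an open set $\mathcal C\subset\mathcal E$ stable under multiplication by positive scalars (an open cone), set $$\tau_{\mathcal C}=\inf\Big\{s\in\mathbb R : \int_{\mathcal C}e^{-s\|x\|}\,d\nu(x)<\infty\Big\}\in[-\infty,\infty].$$ Define $\psi_{\mathcal G}(0)=0$ and, for $x\ne 0$, $\psi_{\mathcal G}(x)=\|x\|\inf\{\tau_{\mathcal C} : \mathcal C \text{ an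 open cone containing } x\}$. Let $\mathcal C_{\mathcal G}$ be the asymptotic cone of $\mathscr P(W)$, that is, the set of limits of convergent sequences $(t_nx_n)$ with $x_n\in\mathscr P(W)$, $t_n\ge 0$ and $t_n\to 0$. For $f\in\mathcal V=\mathbb R^Q$ let $\nabla f\in\mathcal E$ be given by $\nabla f(a)=f(\gamma(a))-f(\sigma(a))$, and let $(\nabla\mathcal V)^\perp$ be the orthogonal subspace of $\nabla\mathcal V$ in $\mathcal E$. Then: 1. $\psi_{\mathcal G}$ takes values in $\mathbb R\cup\{-\infty\}$, and its essential domain $\{x\in\mathcal E : \psi_{\mathcal G}(x)>-\infty\}$, as well as the closure of this domain, is equal to $\mathcal C_{\mathcal G}$. 2. $\mathcal C_{\mathcal G}$ is contained in $(\nabla\mathcal V)^\perp$, and the interior $\overset{\circ}{\mathcal C}_{\mathcal G}$ of $\mathcal C_{\mathcal G}$ relative to $(\nabla\mathcal V)^\perp$ is not empty. 3. On the open subset $\overset{\circ}{\mathcal C}_{\mathcal G}$ of the vector space $(\nabla\mathcal V)^\perp$, the function $\psi_{\mathcal G}$ is real analytic; it is concave there and strictly concave up to homogeneity: $\psi_{\mathcal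 G}(x+y)>\psi_{\mathcal G}(x)+\psi_{\mathcal G}(y)$ for all $x,y\in\overset{\circ}{\mathcal C}_{\mathcal G}$ with $y\notin(0,\infty)x$. 4. If $A$ is not empty and $\mathcal G$ is not cyclic (cyclic means that each vertex is the source of exactly one arrow), then $\psi_{\mathcal G}>0$ on $\overset{\circ}{\mathcal C}_{\mathcal G}$. -/

import Mathlib

open MeasureTheory Filter Topology

/-! ### Indicator of growth of a measure and strict concavity -/

section Growth

variable {E : Type*} [NormedAddCommGroup E] [NormedSpace ℝ E]

/-- An open cone: an open set which is stable under multiplication by positive scalars. -/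
def IsOpenCone (C : Set E) : Prop :=
  IsOpen C ∧ ∀ x ∈ C, ∀ t : ℝ, 0 < t → t • x ∈ C

/-- The exponent of growth `τ` of a measure: the infimum in `[-∞, ∞]` of the real numbers `s` such
that `∫ exp (-s ‖x‖) dμ(x) < ∞`. -/
noncomputable def growthExponent [MeasurableSpace E] (μ : Measure E) : EReal :=
  ⨅ (s : ℝ) (_ : ∫⁻ x, ENNReal.ofReal (Real.exp (-s * ‖x‖)) ∂μ < ⊤), (s : EReal)

open Classical in
/-- The indicator of growth `ψ_μ`: `ψ_μ 0 = 0` and, for `x ≠ 0`, `ψ_μ x` is `‖x‖` times the infimum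
of the exponents of growth of the restrictions of `μ` to the open cones that contain `x`. -/
noncomputable def growthIndicator [MeasurableSpace E] (μ : Measure E) (x : E) : EReal :=
  if x = 0 then 0
  else (‖x‖ : EReal) * ⨅ (C : Set E) (_ : IsOpenCone C ∧ x ∈ C), growthExponent (μ.restrict C)

/-- The essential domain of definition of a function with values in `[-∞, ∞]`. -/
def essentialDomain (ψ : E → EReal) : Set E := {x | ⊥ < ψ x}

/-- A concave function `f` on `U` is strictly concave, in the sense appropriate to positively
homogeneous functions, if `f x + f y < f (x + y)` for all `x`, `y` in `U` such that `y` is not a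
positive multiple of `x`. -/
def HomogeneousStrictConcaveOn (U : Set E) (f : E → ℝ) : Prop :=
  ConcaveOn ℝ U f ∧
    ∀ x ∈ U, ∀ y ∈ U, (¬ ∃ t : ℝ, 0 < t ∧ y = t • x) → f x + f y < f (x + y)

/-- The asymptotic cone of `X` in terms of sequences. -/
theorem mem_asymptoticCone_iff_exists_seq {X : Set E} {v : E} :
    v ∈ asymptoticCone ℝ X ↔
      ∃ (t : ℕ → ℝ) (x : ℕ → E), (∀ n, 0 ≤ t n) ∧ (∀ n, x n ∈ X) ∧
        Tendsto t atTop (𝓝 0) ∧ Tendsto (fun n => t n • x n) atTop (𝓝 v) := by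
  constructor
  · intro h
    rw [mem_asymptoticCone_iff, AffineSpace.asymptoticNhds_eq_smul, ← map₂_smul,
      ← map_prod_eq_map₂, frequently_map] at h
    have hev : ∀ᶠ q : ℝ × E in atTop ×ˢ 𝓝 v, 0 < q.1 :=
      tendsto_fst.eventually (eventually_gt_atTop 0)
    obtain ⟨q, hq, hqX⟩ := exists_seq_forall_of_frequently (h.and_eventually hev)
    refine ⟨fun n => (q n).1⁻¹, fun n => (q n).1 • (q n).2, fun n => ?_, fun n => (hqX n).1,
      ?_, ?_⟩
    · exact (inv_pos.2 (hqX n).2).le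
    · exact (tendsto_fst.comp hq).inv_tendsto_atTop
    · refine (tendsto_snd.comp hq).congr fun n => ?_
      simp [smul_smul, (hqX n).2.ne']
  · rintro ⟨t, x, ht, hx, ht0, hv⟩
    rcases eq_or_ne v 0 with rfl | hv0
    · exact zero_mem_asymptoticCone.2 ⟨x 0, hx 0⟩
    · have hne : ∀ᶠ n in atTop, 0 < t n := by
        filter_upwards [hv.eventually_ne hv0] with n hn
        refine lt_of_le_of_ne (ht n) fun h0 => hn ?_
        simp [← h0]
      have hinv : Tendsto (fun n => (t n)⁻¹) atTop atTop :=
        tendsto_inv_nhdsGT_zero.comp (tendsto_nhdsWithin_iff.2 ⟨ht0, hne⟩)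
      have hlim : Tendsto x atTop (AffineSpace.asymptoticNhds ℝ E v) := by
        refine (hinv.atTop_smul_nhds_tendsto_asymptoticNhds hv).congr' ?_
        filter_upwards [hne] with n hn
        simp [smul_smul, hn.ne']
      exact hlim.frequently (Frequently.of_forall hx)

end Growth

/-! ### Directed graphs and their languages -/

/-- A directed graph with set of vertices `Q` and set of arrows `A`; several arrows may have the
same source and the same target, and loops are allowed. -/
structure DirectedGraph (Q A : Type*) where
  source : A → Q
  target : A → Q

namespace DirectedGraph

variable {Q A : Type*} (G : DirectedGraph Q A)

/-- The language of `G`: the words `a₁ … aₙ`, `n ≥ 0`, such that the target of each letter is the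
source of the next one. -/
def language : Set (List A) :=
  {w | w.IsChain fun a b => G.target a = G.source b}

/-- `G.IsPath q w q'` says that the word `w` is a path from `q` to `q'`. The empty word is a path
from each vertex to itself. -/
def IsPath (q : Q) : List A → Q → Prop
  | [], q' => q = q'
  | a :: w, q' => G.source a = q ∧ IsPath (G.target a) w q'

/-- `G` is connected if any vertex may be joined to any vertex by a path. -/
def Connected : Prop := ∀ q q' : Q, ∃ w : List A, G.IsPath q w q'

/-- `G` is cyclic if each vertex is the source of exactly one arrow. For a connected graph this
says that `G` is a single oriented cycle. -/
def IsCyclic : Prop := ∀ q : Q, ∃! a : A, G.source a = q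

/-- The map `∇`, `∇f (a) = f (target a) - f (source a)`. -/
noncomputable def nabla : (Q → ℝ) →ₗ[ℝ] EuclideanSpace ℝ A where
  toFun f := WithLp.toLp 2 fun a => f (G.target a) - f (G.source a)
  map_add' f g := by
    ext a
    simp only [Pi.add_apply, PiLp.add_apply]
    ring
  map_smul' c f := by
    ext a
    simp only [Pi.smul_apply, PiLp.smul_apply, smul_eq_mul, RingHom.id_apply]
    ring

/-- The orthogonal subspace of the image of `∇`, for the standard inner product. -/
noncomputable def nablaPerp [Fintype A] : Submodule ℝ (EuclideanSpace ℝ A) :=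
  (LinearMap.range G.nabla)ᗮ

end DirectedGraph

/-- The vector of numbers of occurrences of the letters in a word. -/
noncomputable def letterCount {A : Type*} [DecidableEq A] (w : List A) : EuclideanSpace ℝ A :=
  WithLp.toLp 2 fun a => (w.count a : ℝ)

/-- The counting measure of a language `W` on `ℝ^A`: the sum of the Dirac masses at the vectors of
letter counts of the words of `W`. -/
noncomputable def countingMeasure {A : Type*} [DecidableEq A] (W : Set (List A)) :
    Measure (EuclideanSpace ℝ A) :=
  Measure.sum fun w : W => Measure.dirac (letterCount (w : List A))

namespace DirectedGraph

variable {Q A : Type*} [Fintype A] [DecidableEq A] (G : DirectedGraph Q A)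

/-- The function `ψ_G`: the indicator of growth of the counting measure of the language of `G`. -/
noncomputable def psi : EuclideanSpace ℝ A → EReal :=
  growthIndicator (countingMeasure G.language)

/-- The asymptotic cone `C_G` of the set of vectors of letter counts of the words of `G`. -/
noncomputable def cone : Set (EuclideanSpace ℝ A) :=
  asymptoticCone ℝ (letterCount '' G.language)

/-- The interior of `C_G` relative to `(∇V)^⊥`, as a subset of `(∇V)^⊥`. -/
noncomputable def coneInterior : Set G.nablaPerp :=
  interior {x : G.nablaPerp | (x : EuclideanSpace ℝ A) ∈ G.cone}

end DirectedGraph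

/-! ### Growth indicators and linear forms. -/

section Growth

variable {E : Type*} [NormedAddCommGroup E] [NormedSpace ℝ E] [MeasurableSpace E]

/-! On the circulations with positive coordinates, `psi` is the entropy of a Markov chain, and
everything follows from this formula. A positive `x` defines transition probabilities `x a / outflow
x (source a)`. Let `L_x` be the linear form whose coefficients are minus their logarithms
(`potential`); then `entropy x = L_x x`. Upper bound: weights `exp (-L a)` with sum at most 1 at
each vertex become geometrically summable once damped, so `psi ≤ L` away from `0`
(`psi_le_linearForm`). Lower bound: for `L_x` the weights sum to exactly 1 at each vertex, so the
sum over the language diverges, and compactness of the sphere gives `y ≠ 0` with `L_x y ≤ psi y`. If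
`y` is not a positive multiple of `x`, the Gibbs inequality gives `psi y ≤ L_{x+y} y < L_x y`, a
contradiction. So `y` is on the ray of `x`, and `entropy x ≤ psi x` (`entropy_le_psi`). Hence
positive circulations lie in the cone, and they form its relative interior (`coneInterior_eq`).
Strict concavity is the equality case of Gibbs, where connectedness makes a positive circulation
unique up to scaling for given transition probabilities. -/

theorem growthIndicator_lt_coe_iff {μ : Measure E} {x : E} (hx : x ≠ 0) {c : ℝ} :
    growthIndicator μ x < c ↔ ∃ C : Set E, IsOpenCone C ∧ x ∈ C ∧ ∃ s : ℝ, s * ‖x‖ < c ∧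
      ∫⁻ z in C, ENNReal.ofReal (Real.exp (-s * ‖z‖)) ∂μ < ⊤ := by
  have hpos : 0 < ‖x‖ := norm_pos_iff.2 hx
  have key : ∀ t : EReal, (‖x‖ : EReal) * t < c ↔ t < ((c / ‖x‖ : ℝ) : EReal) := by
    intro t
    induction t with
    | bot => simp [EReal.coe_mul_bot_of_pos hpos]
    | top => simp [EReal.coe_mul_top_of_pos hpos]
    | coe t =>
      rw [← EReal.coe_mul, EReal.coe_lt_coe_iff, EReal.coe_lt_coe_iff, lt_div_iff₀ hpos, mul_comm]
  rw [growthIndicator, if_neg hx, key]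
  simp only [growthExponent, iInf_lt_iff, EReal.coe_lt_coe_iff, lt_div_iff₀ hpos, exists_prop]
  constructor
  · rintro ⟨C, ⟨hC, hxC⟩, s, hs, h⟩
    exact ⟨C, hC, hxC, s, h, hs⟩
  · rintro ⟨C, hC, hxC, s, h, hs⟩
    exact ⟨C, ⟨hC, hxC⟩, s, hs, h⟩

variable [BorelSpace E]

/-- If `exp (-φ)` is integrable up to an exponential error, then the linear form `φ` bounds the
indicator of growth from above. -/
theorem growthIndicator_le_of_lintegral_lt_top {μ : Measure E} (φ : E →L[ℝ] ℝ)
    (hφ : ∀ ε : ℝ, 0 < ε → ∫⁻ z, ENNReal.ofReal (Real.exp (-(φ z + ε * ‖z‖))) ∂μ < ⊤)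
    {x : E} (hx : x ≠ 0) : growthIndicator μ x ≤ φ x := by
  have hpos : 0 < ‖x‖ := norm_pos_iff.2 hx
  refine EReal.le_of_forall_lt_iff_le.1 fun c hc => ?_
  rw [EReal.coe_lt_coe_iff] at hc
  refine ((growthIndicator_lt_coe_iff hx).2 ?_).le
  obtain ⟨ε, hε, hεc⟩ : ∃ ε : ℝ, 0 < ε ∧ 3 * (ε * ‖x‖) = c - φ x :=
    ⟨(c - φ x) / 3 / ‖x‖, by have := sub_pos.2 hc; positivity, by field_simp⟩
  have hεx := mul_pos hε hpos
  -- With `s = φ x / ‖x‖ + 2ε`, this is the cone where `exp (-s‖z‖)` is below the integrable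
  -- function. It contains `x` because `s‖x‖ = φ x + 2ε‖x‖`, and `s‖x‖ < c` by the choice of `ε`.
  refine ⟨{z | φ z + ε * ‖z‖ < ((φ x) / ‖x‖ + 2 * ε) * ‖z‖}, ⟨?_, ?_⟩, ?_,
    (φ x) / ‖x‖ + 2 * ε, ?_, ?_⟩
  · exact isOpen_lt (by fun_prop) (by fun_prop)
  · intro z hz t ht
    simp only [Set.mem_ofPred_eq, map_smul, smul_eq_mul, norm_smul, Real.norm_eq_abs,
      abs_of_pos ht] at hz ⊢
    have := mul_lt_mul_of_pos_left hz ht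
    linarith
  · simp only [Set.mem_ofPred_eq, add_mul, div_mul_cancel₀ _ hpos.ne']
    linarith
  · rw [add_mul, div_mul_cancel₀ _ hpos.ne']
    linarith
  · refine lt_of_le_of_lt ?_ (hφ ε hε)
    refine (setLIntegral_mono' (IsOpen.measurableSet ?_) fun z hz => ?_).trans
      (setLIntegral_le_lintegral _ _)
    · exact isOpen_lt (by fun_prop) (by fun_prop)
    · refine ENNReal.ofReal_le_ofReal (Real.exp_le_exp.2 ?_)
      have := Set.mem_ofPred_eq ▸ hz
      linarith

/-- If a linear form dominates strictly the indicator of growth, then its exponential is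
integrable. -/
theorem lintegral_exp_neg_lt_top_of_growthIndicator_lt [ProperSpace E] {μ : Measure E}
    (h0 : μ {0} < ⊤) (φ : E →L[ℝ] ℝ) (hφ : ∀ x : E, x ≠ 0 → growthIndicator μ x < φ x) :
    ∫⁻ z, ENNReal.ofReal (Real.exp (-φ z)) ∂μ < ⊤ := by
  have hcone : ∀ x : E, x ∈ Metric.sphere (0 : E) 1 → ∃ C : Set E, IsOpenCone C ∧ x ∈ C ∧
      ∫⁻ z in C, ENNReal.ofReal (Real.exp (-φ z)) ∂μ < ⊤ := by
    intro x hx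
    have hx0 : x ≠ 0 := by
      rintro rfl
      simp at hx
    obtain ⟨C, hC, hxC, s, hs, hint⟩ := (growthIndicator_lt_coe_iff hx0).1 (hφ x hx0)
    have hU : IsOpen {z | s * ‖z‖ < φ z} := isOpen_lt (by fun_prop) (by fun_prop)
    -- Shrinking the cone makes `exp (-φ)` smaller than `exp (-s‖z‖)` on it.
    refine ⟨C ∩ {z | s * ‖z‖ < φ z}, ⟨hC.1.inter hU, ?_⟩, ⟨hxC, hs⟩, ?_⟩
    · rintro z ⟨hzC, hz⟩ t ht
      refine ⟨hC.2 z hzC t ht, ?_⟩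
      simp only [Set.mem_ofPred_eq, map_smul, smul_eq_mul, norm_smul, Real.norm_eq_abs,
        abs_of_pos ht] at hz ⊢
      have := mul_lt_mul_of_pos_left hz ht
      linarith
    · refine lt_of_le_of_lt ?_ hint
      refine (setLIntegral_mono' (hC.1.inter hU).measurableSet fun z hz => ?_).trans
        (lintegral_mono_set Set.inter_subset_left)
      refine ENNReal.ofReal_le_ofReal (Real.exp_le_exp.2 ?_)
      have : s * ‖z‖ < φ z := hz.2
      linarith
  choose! C hC hxC hint using hcone
  -- By compactness of the unit sphere, finitely many of these cones cover everything but the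
  -- origin, whose mass is controlled by `h0`.
  obtain ⟨t, ht, hcover⟩ := (isCompact_sphere (0 : E) 1).elim_nhds_subcover C
    fun x hx => (hC x hx).1.mem_nhds (hxC x hx)
  have huniv : (Set.univ : Set E) ⊆ {0} ∪ ⋃ x ∈ t, C x := by
    intro z _
    rcases eq_or_ne z 0 with rfl | hz
    · exact Or.inl rfl
    · right
      have hzpos : 0 < ‖z‖ := norm_pos_iff.2 hz
      have hmem : ‖z‖⁻¹ • z ∈ Metric.sphere (0 : E) 1 := by
        simp [norm_smul, hzpos.ne']
      obtain ⟨x, hx, hzx⟩ := Set.mem_iUnion₂.1 (hcover hmem)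
      refine Set.mem_iUnion₂.2 ⟨x, hx, ?_⟩
      have := (hC x (ht x hx)).2 _ hzx ‖z‖ hzpos
      rwa [smul_smul, mul_inv_cancel₀ hzpos.ne', one_smul] at this
  rw [← setLIntegral_univ]
  refine lt_of_le_of_lt (lintegral_mono_set huniv) ?_
  refine lt_of_le_of_lt (lintegral_union_le _ _ _) (ENNReal.add_lt_top.2 ⟨?_, ?_⟩)
  · simpa using h0
  · have hU : ⋃ x ∈ t, C x = ⋃ x : t, C x := by simp [Set.iUnion_subtype]
    rw [hU]
    refine lt_of_le_of_lt (lintegral_iUnion_le _ _) ?_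
    rw [tsum_fintype]
    exact ENNReal.sum_lt_top.2 fun x _ => hint x (ht x x.2)

end Growth

/-! ### Asymptotic cones and open cones. -/

section Cone

variable {E : Type*} [NormedAddCommGroup E] [NormedSpace ℝ E]

/-- Some neighbourhood `U` of `x` has all its dilates `t • U` with `t ≥ R` disjoint from `X`. The
cone generated by `U` can then meet `X` only at scales below `R`. -/
theorem exists_isOpenCone_isBounded_inter {X : Set E} {x : E} (hx : x ∉ asymptoticCone ℝ X) :
    ∃ C : Set E, IsOpenCone C ∧ x ∈ C ∧ Bornology.IsBounded (C ∩ X) := by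
  rw [mem_asymptoticCone_iff, AffineSpace.asymptoticNhds_eq_smul, ← map₂_smul,
    ← map_prod_eq_map₂, frequently_map, not_frequently] at hx
  obtain ⟨p, hp, q, hq, hpq⟩ := eventually_prod_iff.1 hx
  obtain ⟨R, hR⟩ := eventually_atTop.1 hp
  obtain ⟨U, hU, hUo, hxU⟩ := eventually_nhds_iff.1
    (hq.and (Metric.ball_mem_nhds x one_pos))
  refine ⟨⋃ t ∈ Set.Ioi (0 : ℝ), (fun z => t⁻¹ • z) ⁻¹' U, ⟨?_, ?_⟩, ?_, ?_⟩
  · exact isOpen_biUnion fun t _ => hUo.preimage (by fun_prop)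
  · intro z hz r hr
    obtain ⟨t, ht, hzt⟩ := Set.mem_iUnion₂.1 hz
    refine Set.mem_iUnion₂.2 ⟨r * t, mul_pos hr ht, ?_⟩
    simpa [smul_smul, mul_inv_rev, mul_assoc, hr.ne'] using hzt
  · exact Set.mem_iUnion₂.2 ⟨1, Set.mem_Ioi.2 one_pos, by simpa using hxU⟩
  · refine (Metric.isBounded_closedBall (x := (0 : E)) (r := R * (‖x‖ + 1))).subset ?_
    rintro z ⟨hz, hzX⟩
    obtain ⟨t, ht, hzt⟩ := Set.mem_iUnion₂.1 hz
    have ht0 : 0 < t := ht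
    have htz : t • t⁻¹ • z = z := by rw [smul_smul, mul_inv_cancel₀ ht0.ne', one_smul]
    obtain ⟨hqz, hball⟩ := hU _ hzt
    have htR : t < R := by
      by_contra! h
      refine hpq (hR t h) hqz ?_
      simpa [htz] using hzX
    have hnorm : ‖t⁻¹ • z‖ ≤ ‖x‖ + 1 := by
      have h1 : ‖t⁻¹ • z - x‖ < 1 := by simpa [dist_eq_norm] using hball
      have := norm_le_norm_add_norm_sub' (t⁻¹ • z) x
      linarith
    rw [mem_closedBall_zero_iff, ← htz, norm_smul, Real.norm_of_nonneg ht0.le]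
    exact mul_le_mul htR.le hnorm (norm_nonneg _) (ht0.trans htR).le

/-- Eventually `t n • y n`, hence `y n` itself, lies in the cone. Were the intersection finite, `y
n` would be bounded and the limit would be `0`. -/
theorem infinite_inter_of_mem_asymptoticCone {X C : Set E} {x : E} (hx0 : x ≠ 0)
    (hx : x ∈ asymptoticCone ℝ X) (hC : IsOpenCone C) (hxC : x ∈ C) : (C ∩ X).Infinite := by
  intro hfin
  obtain ⟨t, y, ht, hyX, ht0, hlim⟩ := mem_asymptoticCone_iff_exists_seq.1 hx
  obtain ⟨R, hR⟩ := hfin.isBounded.exists_norm_le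
  have hyC : ∀ᶠ n in atTop, ‖y n‖ ≤ R := by
    filter_upwards [hlim.eventually (hC.1.mem_nhds hxC), hlim.eventually_ne hx0] with n hn hn0
    have htn : 0 < t n := (ht n).lt_of_ne fun h => hn0 (by simp [← h])
    refine hR _ ⟨?_, hyX n⟩
    have := hC.2 _ hn (t n)⁻¹ (inv_pos.2 htn)
    rwa [smul_smul, inv_mul_cancel₀ htn.ne', one_smul] at this
  refine hx0 (tendsto_nhds_unique hlim ?_)
  refine squeeze_zero_norm' ?_ (by simpa using ht0.mul_const R)
  filter_upwards [hyC] with n hn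
  rw [norm_smul, Real.norm_of_nonneg (ht n)]
  exact mul_le_mul_of_nonneg_left hn (ht n)

end Cone

/-! ### Circulations, transition probabilities and entropy. -/

section Entropy

open Finset

variable {Q A : Type*} [Fintype A]

/-- The linear form on `ℝ^A` with coefficients `L`. -/
noncomputable def linearForm (L : A → ℝ) : EuclideanSpace ℝ A →L[ℝ] ℝ :=
  ∑ a, L a • EuclideanSpace.proj a

theorem linearForm_apply (L : A → ℝ) (x : EuclideanSpace ℝ A) :
    linearForm L x = ∑ a, L a * x a := by
  simp [linearForm]

namespace DirectedGraph

variable (G : DirectedGraph Q A)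

theorem mem_nablaPerp_iff {x : EuclideanSpace ℝ A} :
    x ∈ G.nablaPerp ↔
      ∀ f : Q → ℝ, ∑ a, (f (G.target a) - f (G.source a)) * x a = 0 := by
  simp [nablaPerp, Submodule.mem_orthogonal, nabla, PiLp.inner_apply, mul_comm]

open Classical in
/-- The sum of the coordinates of `x` at the arrows with source `q`. -/
noncomputable def outflow (x : EuclideanSpace ℝ A) (q : Q) : ℝ :=
  ∑ a with G.source a = q, x a

theorem le_outflow {x : EuclideanSpace ℝ A} (hx : ∀ a, 0 ≤ x a) (a : A) :
    x a ≤ G.outflow x (G.source a) := by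
  classical
  exact single_le_sum (f := fun b => x b) (fun b _ => hx b) (by simp)

theorem outflow_source_pos {x : EuclideanSpace ℝ A} (hx : ∀ a, 0 < x a) (a : A) :
    0 < G.outflow x (G.source a) :=
  (hx a).trans_le (G.le_outflow (fun b => (hx b).le) a)

/-- The logarithms of the inverses of the transition probabilities attached to `x`. -/
noncomputable def potential (x : EuclideanSpace ℝ A) (a : A) : ℝ :=
  Real.log (G.outflow x (G.source a)) - Real.log (x a)

/-- The entropy of `x`. -/
noncomputable def entropy (x : EuclideanSpace ℝ A) : ℝ :=
  linearForm (G.potential x) x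

theorem exp_neg_potential {x : EuclideanSpace ℝ A} (hx : ∀ a, 0 < x a) (a : A) :
    Real.exp (-G.potential x a) = x a / G.outflow x (G.source a) := by
  rw [potential, neg_sub, Real.exp_sub, Real.exp_log (hx a),
    Real.exp_log (G.outflow_source_pos hx a)]

open Classical in
theorem sum_exp_neg_potential {x : EuclideanSpace ℝ A} (hx : ∀ a, 0 < x a) {q : Q}
    (hq : ∃ a, G.source a = q) :
    ∑ a with G.source a = q, Real.exp (-G.potential x a) = 1 := by
  obtain ⟨b, rfl⟩ := hq
  have : ∀ a ∈ univ.filter (fun a => G.source a = G.source b),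
      Real.exp (-G.potential x a) = x a / G.outflow x (G.source b) := by
    intro a ha
    rw [G.exp_neg_potential hx, (mem_filter.1 ha).2]
  rw [sum_congr rfl this, ← sum_div]
  exact div_self (G.outflow_source_pos hx b).ne'

open Classical in
theorem sum_exp_neg_potential_le {x : EuclideanSpace ℝ A} (hx : ∀ a, 0 < x a) (q : Q) :
    ∑ a with G.source a = q, Real.exp (-G.potential x a) ≤ 1 := by
  by_cases hq : ∃ a, G.source a = q
  · exact (G.sum_exp_neg_potential hx hq).le
  · rw [filter_eq_empty_iff.2 fun a _ h => hq ⟨a, h⟩]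
    simp

/-- Exchange of summations for a function which depends on the source of the arrows. -/
theorem sum_exp_neg_potential_mul_outflow (x : EuclideanSpace ℝ A) {z : EuclideanSpace ℝ A}
    (hz : ∀ a, 0 < z a) :
    ∑ a, Real.exp (-G.potential z a) * G.outflow x (G.source a) = ∑ a, x a := by
  classical
  have h : ∀ a, Real.exp (-G.potential z a) * G.outflow x (G.source a)
      = ∑ b, if G.source b = G.source a then Real.exp (-G.potential z a) * x b else 0 := by
    intro a
    rw [outflow, mul_sum, sum_filter]
  rw [sum_congr rfl fun a _ => h a, sum_comm]
  refine sum_congr rfl fun b _ => ?_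
  have h2 : ∀ a, (if G.source b = G.source a then Real.exp (-G.potential z a) * x b else 0)
      = (if G.source a = G.source b then Real.exp (-G.potential z a) else 0) * x b := by
    intro a
    split_ifs with h1 h2 h2
    · rfl
    · exact absurd h1.symm h2
    · exact absurd h2.symm h1
    · simp
  rw [sum_congr rfl fun a _ => h2 a, ← sum_mul, ← sum_filter,
    G.sum_exp_neg_potential hz ⟨b, rfl⟩, one_mul]

/-- The Gibbs inequality. -/
theorem entropy_le_linearForm_potential {x z : EuclideanSpace ℝ A} (hx : ∀ a, 0 < x a)
    (hz : ∀ a, 0 < z a) : G.entropy x ≤ linearForm (G.potential z) x ∧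
      (G.entropy x = linearForm (G.potential z) x → G.potential z = G.potential x) := by
  -- This is `1 - exp (-v) ≤ v`, strict unless `v = 0`, multiplied by `x a`, where `v` is the
  -- difference of potentials. The left sides sum to zero because the weights of `z` are
  -- probabilities.
  have hterm : ∀ a, x a - Real.exp (-G.potential z a) * G.outflow x (G.source a)
      ≤ (G.potential z a - G.potential x a) * x a ∧
      ((G.potential z a - G.potential x a) * x a
        = x a - Real.exp (-G.potential z a) * G.outflow x (G.source a) →
        G.potential z a = G.potential x a) := by
    intro a
    have hex : Real.exp (-G.potential z a) * G.outflow x (G.source a)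
        = Real.exp (-(G.potential z a - G.potential x a)) * x a := by
      rw [neg_sub, sub_eq_add_neg, add_comm, Real.exp_add, mul_assoc]
      congr 1
      rw [potential, Real.exp_sub, Real.exp_log (hx a),
        Real.exp_log (G.outflow_source_pos hx a), div_mul_cancel₀ _ (hx a).ne']
    rw [hex]
    set v := G.potential z a - G.potential x a with hv
    refine ⟨by nlinarith [Real.add_one_le_exp (-v), hx a], fun h => ?_⟩
    by_contra hne
    have hv0 : -v ≠ 0 := by
      intro h0
      exact hne (by linarith)
    have h1 := Real.add_one_lt_exp hv0
    have h2 : (v - 1 + Real.exp (-v)) * x a = 0 := by linarith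
    rcases mul_eq_zero.1 h2 with h3 | h3
    · linarith
    · exact (hx a).ne' h3
  have hsum : ∑ a, (x a - Real.exp (-G.potential z a) * G.outflow x (G.source a)) = 0 := by
    rw [sum_sub_distrib, G.sum_exp_neg_potential_mul_outflow x hz, sub_self]
  have hdiff : ∑ a, (G.potential z a - G.potential x a) * x a
      = linearForm (G.potential z) x - G.entropy x := by
    rw [entropy, linearForm_apply, linearForm_apply, ← sum_sub_distrib]
    exact sum_congr rfl fun a _ => sub_mul _ _ _
  have hle := sum_le_sum fun a (_ : a ∈ univ) => (hterm a).1
  refine ⟨by linarith, fun h => funext fun a => (hterm a).2 ?_⟩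
  have heq : ∑ a, (x a - Real.exp (-G.potential z a) * G.outflow x (G.source a))
      = ∑ a, (G.potential z a - G.potential x a) * x a := by linarith
  exact ((sum_eq_sum_iff_of_le fun a _ => (hterm a).1).1 heq a (mem_univ a)).symm

variable {G}

omit [Fintype A] in
theorem IsPath.eq_of_forall_arrow {f : Q → ℝ} (hf : ∀ a, f (G.source a) = f (G.target a)) :
    ∀ {q q' : Q} {w : List A}, G.IsPath q w q' → f q = f q'
  | _, _, [], h => congrArg f h
  | _, _, _ :: _, ⟨h, h'⟩ => by rw [← h, hf, IsPath.eq_of_forall_arrow hf h']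

/-- In a connected graph the transition probabilities determine the positive circulations up to
scaling. -/
theorem exists_eq_smul_of_potential_eq (hG : G.Connected) {x z : EuclideanSpace ℝ A}
    (hx : ∀ a, 0 < x a) (hz : ∀ a, 0 < z a) (hxG : x ∈ G.nablaPerp) (hzG : z ∈ G.nablaPerp)
    (h : G.potential z = G.potential x) : ∃ t : ℝ, 0 < t ∧ z = t • x := by
  rcases isEmpty_or_nonempty A with hA | ⟨⟨a₀⟩⟩
  · exact ⟨1, one_pos, by ext a; exact hA.elim a⟩
  rw [mem_nablaPerp_iff] at hxG hzG
  set r : Q → ℝ := fun q => G.outflow z q / G.outflow x q with hr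
  have hzr : ∀ a, z a = r (G.source a) * x a := by
    intro a
    have h1 := congrArg (fun f => Real.exp (-f a)) h
    simp only [G.exp_neg_potential hx, G.exp_neg_potential hz] at h1
    have hx' := G.outflow_source_pos hx a
    have hz' := G.outflow_source_pos hz a
    rw [div_eq_div_iff hz'.ne' hx'.ne'] at h1
    simp only [hr]
    rw [div_mul_eq_mul_div, eq_div_iff hx'.ne', h1, mul_comm]
  -- The energy of `r` vanishes: with `z = r x` along sources, it is the pairing of `x` with the
  -- gradient of `r ^ 2` minus twice that of `z` with the gradient of `r`.
  have hvar : ∑ a, (r (G.source a) - r (G.target a)) ^ 2 * x a = 0 := by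
    have h1 := hxG fun q => r q ^ 2
    have h2 := hzG r
    have h3 : ∑ a, (r (G.source a) - r (G.target a)) ^ 2 * x a
        = ∑ a, (r (G.target a) ^ 2 - r (G.source a) ^ 2) * x a
          - 2 * ∑ a, (r (G.target a) - r (G.source a)) * z a := by
      rw [mul_sum, ← sum_sub_distrib]
      refine sum_congr rfl fun a _ => ?_
      rw [hzr a]
      ring
    rw [h3, h1, h2]
    simp
  have hconst : ∀ a, r (G.source a) = r (G.target a) := by
    intro a
    have := (sum_eq_zero_iff_of_nonneg fun a _ =>
      mul_nonneg (sq_nonneg (r (G.source a) - r (G.target a))) (hx a).le).1 hvar a (mem_univ a)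
    rcases mul_eq_zero.1 this with h | h
    · exact sub_eq_zero.1 (pow_eq_zero_iff two_ne_zero |>.1 h)
    · exact absurd h (hx a).ne'
  refine ⟨r (G.source a₀), div_pos (G.outflow_source_pos hz a₀) (G.outflow_source_pos hx a₀), ?_⟩
  ext a
  obtain ⟨w, hw⟩ := hG (G.source a) (G.source a₀)
  rw [PiLp.smul_apply, smul_eq_mul, ← hw.eq_of_forall_arrow hconst, hzr a]

theorem entropy_lt_linearForm_potential (hG : G.Connected) {x z : EuclideanSpace ℝ A}
    (hx : ∀ a, 0 < x a) (hz : ∀ a, 0 < z a) (hxG : x ∈ G.nablaPerp) (hzG : z ∈ G.nablaPerp)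
    (h : ¬ ∃ t : ℝ, 0 < t ∧ z = t • x) : G.entropy x < linearForm (G.potential z) x := by
  obtain ⟨hle, heq⟩ := G.entropy_le_linearForm_potential hx hz
  exact hle.lt_of_ne fun h' => h (exists_eq_smul_of_potential_eq hG hx hz hxG hzG (heq h'))

variable (G)

theorem outflow_smul (t : ℝ) (x : EuclideanSpace ℝ A) (q : Q) :
    G.outflow (t • x) q = t * G.outflow x q := by
  simp [outflow, mul_sum]

theorem entropy_smul {x : EuclideanSpace ℝ A} (hx : ∀ a, 0 < x a) {t : ℝ} (ht : 0 < t) :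
    G.entropy (t • x) = t * G.entropy x := by
  have : G.potential (t • x) = G.potential x := by
    funext a
    have h1 := (G.outflow_source_pos hx a).ne'
    rw [potential, potential, outflow_smul, PiLp.smul_apply, smul_eq_mul,
      Real.log_mul ht.ne' h1, Real.log_mul ht.ne' (hx a).ne']
    ring
  rw [entropy, this, map_smul, smul_eq_mul, entropy]

variable {G}

theorem not_add_eq_smul {x y : EuclideanSpace ℝ A} (hx : ∀ a, 0 < x a) (hy0 : y ≠ 0)
    (hy : ∀ a, 0 ≤ y a) (h : ¬ ∃ t : ℝ, 0 < t ∧ y = t • x) :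
    ¬ ∃ t : ℝ, 0 < t ∧ x + y = t • x := by
  rintro ⟨t, -, hxy⟩
  have hyt : y = (t - 1) • x := by
    rw [sub_smul, one_smul, ← hxy, add_sub_cancel_left]
  obtain ⟨a, ha⟩ : ∃ a, y a ≠ 0 := by
    by_contra! h0
    exact hy0 (by ext a; exact h0 a)
  have h1 : 0 < y a := (hy a).lt_of_ne ha.symm
  refine h ⟨t - 1, ?_, hyt⟩
  rw [hyt, PiLp.smul_apply, smul_eq_mul] at h1
  exact (pos_iff_pos_of_mul_pos h1).2 (hx a)

/-- Subtract two Gibbs inequalities: `L_{x+y} (x+y) < L_x (x+y)` and `L_x x ≤ L_{x+y} x`. Only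
potentials at `x` and `x + y` occur, so `y` may have zero coordinates. -/
theorem linearForm_potential_add_lt (hG : G.Connected) {x y : EuclideanSpace ℝ A}
    (hx : ∀ a, 0 < x a) (hxG : x ∈ G.nablaPerp) (hy0 : y ≠ 0) (hy : ∀ a, 0 ≤ y a)
    (hyG : y ∈ G.nablaPerp) (h : ¬ ∃ t : ℝ, 0 < t ∧ y = t • x) :
    linearForm (G.potential (x + y)) y < linearForm (G.potential x) y := by
  have hxy : ∀ a, 0 < (x + y) a := fun a => add_pos_of_pos_of_nonneg (hx a) (hy a)
  have hne := not_add_eq_smul hx hy0 hy h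
  have h1 : G.entropy (x + y) < linearForm (G.potential x) (x + y) := by
    refine entropy_lt_linearForm_potential hG hxy hx (G.nablaPerp.add_mem hxG hyG) hxG ?_
    rintro ⟨t, ht, hxt⟩
    refine hne ⟨t⁻¹, inv_pos.2 ht, ?_⟩
    conv_rhs => rw [hxt]
    rw [smul_smul, inv_mul_cancel₀ ht.ne', one_smul]
  have h2 := (G.entropy_le_linearForm_potential hx hxy).1
  simp only [entropy, map_add] at h1 h2
  linarith

/-- The form `L_{x+y}` equals the entropy at `x + y` and bounds it above at `x` and at `y`. -/
theorem entropy_add_le {x y : EuclideanSpace ℝ A} (hx : ∀ a, 0 < x a) (hy : ∀ a, 0 < y a) :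
    G.entropy x + G.entropy y ≤ G.entropy (x + y) := by
  have hxy : ∀ a, 0 < (x + y) a := fun a => add_pos (hx a) (hy a)
  have h1 := (G.entropy_le_linearForm_potential hx hxy).1
  have h2 := (G.entropy_le_linearForm_potential hy hxy).1
  rw [entropy.eq_1 G (x + y), map_add]
  exact add_le_add h1 h2

theorem entropy_add_lt (hG : G.Connected) {x y : EuclideanSpace ℝ A}
    (hx : ∀ a, 0 < x a) (hy : ∀ a, 0 < y a) (hxG : x ∈ G.nablaPerp) (hyG : y ∈ G.nablaPerp)
    (h : ¬ ∃ t : ℝ, 0 < t ∧ y = t • x) :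
    G.entropy x + G.entropy y < G.entropy (x + y) := by
  have hxy : ∀ a, 0 < (x + y) a := fun a => add_pos (hx a) (hy a)
  have hy0 : y ≠ 0 := by
    rintro rfl
    refine h ⟨1, one_pos, ?_⟩
    ext a
    exact absurd (hy a) (by simp)
  have h1 := entropy_lt_linearForm_potential hG hx hxy hxG (G.nablaPerp.add_mem hxG hyG)
    (not_add_eq_smul hx hy0 (fun a => (hy a).le) h)
  have h2 := (G.entropy_le_linearForm_potential hy hxy).1
  rw [entropy.eq_1 G (x + y), map_add]
  exact add_lt_add_of_lt_of_le h1 h2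

omit [Fintype A] in
theorem exists_arrow (hG : G.Connected) [Nonempty A] (q : Q) : ∃ a, G.source a = q := by
  obtain ⟨a⟩ := ‹Nonempty A›
  obtain ⟨w, hw⟩ := hG q (G.source a)
  cases w with
  | nil => exact ⟨a, Eq.symm hw⟩
  | cons b w => exact ⟨b, hw.1⟩

/-- The entropy is a sum of nonnegative terms, as transition probabilities are at most 1. If it
vanished, all of them would equal 1, leaving a single arrow out of each vertex. -/
theorem entropy_pos (hG : G.Connected) [Nonempty A] (hcyc : ¬ G.IsCyclic)
    {x : EuclideanSpace ℝ A} (hx : ∀ a, 0 < x a) : 0 < G.entropy x := by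
  have hnn : ∀ a, 0 ≤ G.potential x a := fun a =>
    sub_nonneg.2 (Real.log_le_log (hx a) (G.le_outflow (fun b => (hx b).le) a))
  rw [entropy, linearForm_apply]
  refine (sum_nonneg fun a _ => mul_nonneg (hnn a) (hx a).le).lt_of_ne fun h => hcyc fun q => ?_
  have h0 : ∀ a, x a = G.outflow x (G.source a) := by
    intro a
    have := (sum_eq_zero_iff_of_nonneg fun a _ => mul_nonneg (hnn a) (hx a).le).1 h.symm a
      (mem_univ a)
    have h1 := (mul_eq_zero.1 this).resolve_right (hx a).ne'
    exact (Real.log_injOn_pos (G.outflow_source_pos hx a) (hx a) (sub_eq_zero.1 h1)).symm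
  obtain ⟨a, rfl⟩ := exists_arrow hG q
  refine ⟨a, rfl, fun b hb => ?_⟩
  by_contra hne
  classical
  have : x b + x a ≤ G.outflow x (G.source a) := by
    rw [← sum_pair (f := fun c => x c) hne]
    refine sum_le_sum_of_subset_of_nonneg ?_ fun c _ _ => (hx c).le
    intro c hc
    rcases mem_insert.1 hc with rfl | hc
    · simp [hb]
    · simp [mem_singleton.1 hc]
  linarith [hx b, h0 a]

theorem analyticOnNhd_entropy :
    AnalyticOnNhd ℝ G.entropy {x : EuclideanSpace ℝ A | ∀ a, 0 < x a} := by
  have hproj : ∀ a x, AnalyticAt ℝ (fun x : EuclideanSpace ℝ A => x a) x := fun a x =>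
    (EuclideanSpace.proj (𝕜 := ℝ) a).analyticAt x
  have : G.entropy = fun x => ∑ a, G.potential x a * x a := funext fun x => by
    rw [entropy, linearForm_apply]
  rw [this]
  intro x hx
  refine Finset.analyticAt_fun_sum _ fun a _ => ?_
  have hout : AnalyticAt ℝ (fun x => G.outflow x (G.source a)) x :=
    Finset.analyticAt_fun_sum _ fun b _ => hproj b x
  have hlog : ∀ {f : EuclideanSpace ℝ A → ℝ}, AnalyticAt ℝ f x → 0 < f x →
      AnalyticAt ℝ (fun x => Real.log (f x)) x := fun hf h =>
    (analyticAt_log h).fun_comp hf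
  exact ((hlog hout (G.outflow_source_pos hx a)).fun_sub (hlog (hproj a x) (hx a))).fun_mul
    (hproj a x)

end DirectedGraph

end Entropy

/-! ### Weighted sums over paths. -/

section Words

open Finset
open scoped ENNReal

variable {Q A : Type*}

theorem ENNReal.tsum_list [Fintype A] (f : List A → ℝ≥0∞) :
    ∑' w, f w = ∑' n, ∑ v : Fin n → A, f (List.ofFn v) := by
  rw [← List.equivSigmaTuple.symm.tsum_eq f, ENNReal.tsum_sigma']
  exact tsum_congr fun n => tsum_fintype _

namespace DirectedGraph

variable (G : DirectedGraph Q A)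

open Classical in
/-- The product of the weights of the letters of a word if this word is a path which starts
from `q`, and `0` otherwise. -/
noncomputable def pathWeight (p : A → ℝ≥0∞) : Q → List A → ℝ≥0∞
  | _, [] => 1
  | q, a :: w => if G.source a = q then p a * pathWeight p (G.target a) w else 0

theorem pathWeight_source_eq_prod (p : A → ℝ≥0∞) :
    ∀ (a : A) (w : List A), a :: w ∈ G.language →
      G.pathWeight p (G.source a) (a :: w) = ((a :: w).map p).prod
  | a, [], _ => by simp [pathWeight]
  | a, b :: w, h => by
    obtain ⟨hab, hw⟩ := List.isChain_cons_cons.1 h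
    rw [pathWeight, if_pos rfl, hab, pathWeight_source_eq_prod p b w hw, List.map_cons (a := a),
      List.prod_cons]

theorem pathWeight_eq_prod_or_eq_zero (p : A → ℝ≥0∞) :
    ∀ (q : Q) (w : List A), G.pathWeight p q w = 0 ∨
      (w ∈ G.language ∧ (∀ a ∈ w.head?, G.source a = q) ∧ G.pathWeight p q w = (w.map p).prod)
  | q, [] => Or.inr ⟨List.isChain_nil, by simp, by simp [pathWeight]⟩
  | q, a :: w => by
    by_cases hq : G.source a = q
    · rw [pathWeight, if_pos hq]
      rcases pathWeight_eq_prod_or_eq_zero p (G.target a) w with h | ⟨hw, hh, h⟩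
      · exact Or.inl (by rw [h, mul_zero])
      · refine Or.inr ⟨List.isChain_cons.2 ⟨fun b hb => (hh b hb).symm, hw⟩, by simpa using hq, ?_⟩
        rw [h, List.map_cons, List.prod_cons]
    · exact Or.inl (by rw [pathWeight, if_neg hq])

variable [Fintype A]

theorem sum_pathWeight_succ (p : A → ℝ≥0∞) (q : Q) (n : ℕ) [DecidableEq Q] :
    ∑ v : Fin (n + 1) → A, G.pathWeight p q (List.ofFn v) =
      ∑ a with G.source a = q, p a * ∑ v : Fin n → A, G.pathWeight p (G.target a) (List.ofFn v) := by
  rw [← (Fin.consEquiv fun _ => A).sum_comp, Fintype.sum_prod_type, sum_filter]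
  refine sum_congr rfl fun a _ => ?_
  have h : ∀ v : Fin n → A, G.pathWeight p q (List.ofFn ((Fin.consEquiv fun _ => A) (a, v)))
      = if G.source a = q then p a * G.pathWeight p (G.target a) (List.ofFn v) else 0 := by
    intro v
    rw [Fin.consEquiv, Equiv.coe_fn_mk, List.ofFn_cons, pathWeight]
    congr
  rw [sum_congr rfl fun v _ => h v]
  split_ifs with hq
  · rw [mul_sum]
  · simp

/-- Removing the first letter shows that the paths of length `n` from `q` have total weight at most
`ρ ^ n`. -/
theorem tsum_pathWeight_lt_top [DecidableEq Q] {p : A → ℝ≥0∞} {ρ : ℝ≥0∞} (hρ : ρ < 1)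
    (hp : ∀ q, ∑ a with G.source a = q, p a ≤ ρ) (q : Q) :
    ∑' w, G.pathWeight p q w < ⊤ := by
  have hn : ∀ (n : ℕ) (q : Q), ∑ v : Fin n → A, G.pathWeight p q (List.ofFn v) ≤ ρ ^ n := by
    intro n
    induction n with
    | zero => simp [pathWeight]
    | succ n ih =>
      intro q
      rw [sum_pathWeight_succ, pow_succ']
      calc _ ≤ ∑ a with G.source a = q, p a * ρ ^ n := by gcongr; exact ih _
        _ = (∑ a with G.source a = q, p a) * ρ ^ n := by rw [sum_mul]
        _ ≤ _ := by gcongr; exact hp q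
  rw [ENNReal.tsum_list]
  refine (ENNReal.tsum_le_tsum fun n => hn n q).trans_lt ?_
  rw [ENNReal.tsum_geometric, ENNReal.inv_lt_top]
  exact tsub_pos_of_lt hρ

/-- Probability is conserved: each length contributes exactly 1. -/
theorem tsum_pathWeight_eq_top [DecidableEq Q] {p : A → ℝ≥0∞}
    (hp : ∀ q, ∑ a with G.source a = q, p a = 1) (q : Q) : ∑' w, G.pathWeight p q w = ⊤ := by
  have hn : ∀ (n : ℕ) (q : Q), ∑ v : Fin n → A, G.pathWeight p q (List.ofFn v) = 1 := by
    intro n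
    induction n with
    | zero => simp [pathWeight]
    | succ n ih =>
      intro q
      rw [sum_pathWeight_succ, sum_congr rfl fun a _ => by rw [ih (G.target a), mul_one], hp]
  rw [ENNReal.tsum_list, tsum_congr fun n => hn n q]
  exact ENNReal.tsum_const_eq_top_of_ne_zero one_ne_zero

end DirectedGraph

/-! ### Letter counts and the counting measure. -/

variable [Fintype A] [DecidableEq A]

omit [Fintype A] in
theorem letterCount_apply (w : List A) (a : A) : letterCount w a = w.count a := rfl

theorem linearForm_letterCount (L : A → ℝ) (w : List A) :
    linearForm L (letterCount w) = (w.map L).sum := by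
  rw [linearForm_apply]
  simp only [letterCount_apply]
  induction w with
  | nil => simp
  | cons b w ih =>
    simp only [List.count_cons, Nat.cast_add, mul_add, sum_add_distrib, ih, List.map_cons,
      List.sum_cons]
    simp [add_comm]

theorem length_eq_sum_letterCount (w : List A) : (w.length : ℝ) = ∑ a, letterCount w a := by
  have := linearForm_letterCount (fun _ => 1) w
  rw [linearForm_apply] at this
  simpa using this.symm

theorem length_le_norm_letterCount (w : List A) :
    (w.length : ℝ) ≤ Fintype.card A * ‖letterCount w‖ := by
  rw [length_eq_sum_letterCount, ← nsmul_eq_mul]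
  exact sum_le_card_nsmul _ _ _ fun a _ =>
    (le_abs_self _).trans (PiLp.norm_apply_le (letterCount w) a)

theorem prod_map_ofReal_exp_neg (L : A → ℝ) (w : List A) :
    (w.map fun a => ENNReal.ofReal (Real.exp (-L a))).prod =
      ENNReal.ofReal (Real.exp (-linearForm L (letterCount w))) := by
  rw [linearForm_letterCount]
  induction w with
  | nil => simp
  | cons b w ih =>
    rw [List.map_cons, List.prod_cons, ih, List.map_cons, List.sum_cons, neg_add, Real.exp_add,
      ENNReal.ofReal_mul (Real.exp_pos _).le]

theorem finite_setOf_norm_letterCount_le (R : ℝ) : {w : List A | ‖letterCount w‖ ≤ R}.Finite := by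
  refine (List.finite_length_le A ⌊Fintype.card A * R⌋₊).subset fun w hw => Nat.le_floor ?_
  exact (length_le_norm_letterCount w).trans
    (mul_le_mul_of_nonneg_left hw (Nat.cast_nonneg _))

omit [Fintype A] in
theorem lintegral_countingMeasure (W : Set (List A)) {f : EuclideanSpace ℝ A → ℝ≥0∞}
    (hf : Measurable f) :
    ∫⁻ x, f x ∂(countingMeasure W) = ∑' w : W, f (letterCount (w : List A)) := by
  rw [countingMeasure, lintegral_sum_measure]
  exact tsum_congr fun w => lintegral_dirac' _ hf

omit [Fintype A] in
theorem setLIntegral_countingMeasure (W : Set (List A)) {C : Set (EuclideanSpace ℝ A)}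
    (hC : MeasurableSet C) {f : EuclideanSpace ℝ A → ℝ≥0∞} (hf : Measurable f) :
    ∫⁻ x in C, f x ∂(countingMeasure W) =
      ∑' w : W, C.indicator f (letterCount (w : List A)) := by
  rw [← lintegral_indicator hC, lintegral_countingMeasure W (hf.indicator hC)]

theorem countingMeasure_singleton_zero_lt_top (W : Set (List A)) :
    countingMeasure W {(0 : EuclideanSpace ℝ A)} < ⊤ := by
  have hm : MeasurableSet {(0 : EuclideanSpace ℝ A)} := measurableSet_singleton 0
  rw [← lintegral_indicator_one hm, lintegral_countingMeasure W (measurable_one.indicator hm)]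
  -- Only the empty word has letter count zero.
  refine lt_of_le_of_lt (ENNReal.tsum_le_tsum (g := fun w : W => ({[]} : Set (List A)).indicator 1
    (w : List A)) fun w => ?_) ?_
  · by_cases hw : (w : List A) = []
    · simp only [Set.indicator, hw, Set.mem_singleton_iff, if_true]
      split_ifs <;> simp
    · have h0 : letterCount (w : List A) ≠ 0 := by
        intro h0
        have := length_eq_sum_letterCount (w : List A)
        rw [h0] at this
        simp [hw] at this
      simp [Set.indicator, h0]
  · refine lt_of_le_of_lt (ENNReal.tsum_comp_le_tsum_of_injective Subtype.val_injective _) ?_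
    rw [tsum_eq_single []]
    · simp
    · intro w hw
      simp [hw]

end Words

/-! ### The growth indicator of the language of a graph. -/

namespace DirectedGraph

open Finset
open scoped ENNReal

variable {Q A : Type*} [Fintype A] (G : DirectedGraph Q A)

theorem tsum_language_lt_top [Fintype Q] [DecidableEq Q] {p : A → ℝ≥0∞} {ρ : ℝ≥0∞} (hρ : ρ < 1)
    (hp : ∀ q, ∑ a with G.source a = q, p a ≤ ρ) :
    ∑' w : G.language, ((w : List A).map p).prod < ⊤ := by
  classical
  -- A nonempty word is counted from its own starting vertex; the separate term covers the empty
  -- word, even when `Q` is empty.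
  have hle : ∀ w : G.language, ((w : List A).map p).prod ≤
      (if (w : List A) = [] then 1 else 0) + ∑ q, G.pathWeight p q w := by
    rintro ⟨w, hw⟩
    cases w with
    | nil => simp
    | cons a w =>
      rw [← G.pathWeight_source_eq_prod p a w hw]
      exact (single_le_sum (f := fun q => G.pathWeight p q (a :: w)) (fun _ _ => zero_le)
        (mem_univ _)).trans le_add_self
  refine (ENNReal.tsum_le_tsum hle).trans_lt ?_
  refine (ENNReal.tsum_comp_le_tsum_of_injective Subtype.val_injective fun w : List A =>
    (if w = [] then 1 else 0) + ∑ q, G.pathWeight p q w).trans_lt ?_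
  rw [ENNReal.tsum_add, ENNReal.add_lt_top, tsum_ite_eq,
    Summable.tsum_finsetSum fun _ _ => ENNReal.summable]
  exact ⟨ENNReal.one_lt_top, ENNReal.sum_lt_top.2 fun q _ => G.tsum_pathWeight_lt_top hρ hp q⟩

theorem tsum_language_eq_top [Nonempty Q] [DecidableEq Q] {p : A → ℝ≥0∞}
    (hp : ∀ q, ∑ a with G.source a = q, p a = 1) :
    ∑' w : G.language, ((w : List A).map p).prod = ⊤ := by
  obtain ⟨q⟩ := ‹Nonempty Q›
  rw [eq_top_iff, ← G.tsum_pathWeight_eq_top hp q,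
    tsum_subtype G.language fun w => (w.map p).prod]
  refine ENNReal.tsum_le_tsum fun w => ?_
  rcases G.pathWeight_eq_prod_or_eq_zero p q w with h | ⟨hw, -, h⟩
  · simp [h]
  · rw [h, Set.indicator_of_mem hw]

variable [DecidableEq A]

/-- An extra cost `δ` per letter makes the weights strictly substochastic, with ratio `exp (-δ)`. As
length is at most `card A` times the norm, this cost is absorbed by the allowed error `ε‖z‖`. -/
theorem psi_le_linearForm [Fintype Q] [DecidableEq Q] {L : A → ℝ}
    (hL : ∀ q, ∑ a with G.source a = q, Real.exp (-L a) ≤ 1) {x : EuclideanSpace ℝ A}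
    (hx : x ≠ 0) : G.psi x ≤ (linearForm L x : ℝ) := by
  refine growthIndicator_le_of_lintegral_lt_top (linearForm L) (fun ε hε => ?_) hx
  rw [lintegral_countingMeasure _ (by fun_prop)]
  -- The `+ 1` keeps the denominator positive when `A` is empty.
  set δ : ℝ := ε / (Fintype.card A + 1) with hδ
  have hδ0 : 0 < δ := by positivity
  set p : A → ℝ≥0∞ := fun a => ENNReal.ofReal (Real.exp (-(L a + δ))) with hp
  refine lt_of_le_of_lt (ENNReal.tsum_le_tsum fun w => ?_)
    (G.tsum_language_lt_top (p := p) (ρ := ENNReal.ofReal (Real.exp (-δ))) ?_ fun q => ?_)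
  · rw [hp, prod_map_ofReal_exp_neg fun a => L a + δ]
    refine ENNReal.ofReal_le_ofReal (Real.exp_le_exp.2 (neg_le_neg ?_))
    have h1 : linearForm (fun a => L a + δ) (letterCount (w : List A))
        = linearForm L (letterCount (w : List A)) + δ * (w : List A).length := by
      rw [length_eq_sum_letterCount, linearForm_apply, linearForm_apply, mul_sum,
        ← sum_add_distrib]
      exact sum_congr rfl fun a _ => add_mul _ _ _
    have h2 : δ * (w : List A).length ≤ δ * ((Fintype.card A + 1) * ‖letterCount (w : List A)‖) := by
      refine mul_le_mul_of_nonneg_left ((length_le_norm_letterCount _).trans ?_) hδ0.le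
      exact mul_le_mul_of_nonneg_right (by linarith) (norm_nonneg _)
    have h3 : δ * ((Fintype.card A + 1) * ‖letterCount (w : List A)‖)
        = ε * ‖letterCount (w : List A)‖ := by
      rw [hδ]
      field_simp
    linarith
  · rw [ENNReal.ofReal_lt_one, Real.exp_lt_one_iff]
    linarith
  · rw [hp, ← ENNReal.ofReal_sum_of_nonneg fun a _ => (Real.exp_pos _).le]
    refine ENNReal.ofReal_le_ofReal ?_
    simp only [neg_add, Real.exp_add]
    rw [← sum_mul]
    exact mul_le_of_le_one_left (Real.exp_pos _).le (hL q)

/-- A negative value would give an integrable exponent `s ≤ 0` on an open cone around `x`. Each of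
the infinitely many letter vectors there contributes at least 1, so the integral diverges. -/
theorem zero_le_psi_of_mem_cone {x : EuclideanSpace ℝ A} (hx : x ∈ G.cone) : 0 ≤ G.psi x := by
  rcases eq_or_ne x 0 with rfl | hx0
  · simp [psi, growthIndicator]
  by_contra! h
  obtain ⟨C, hC, hxC, s, hs, hint⟩ := (growthIndicator_lt_coe_iff hx0).1 h
  have hs0 : s ≤ 0 := by
    by_contra! hs0
    exact hs.not_ge (mul_nonneg hs0.le (norm_nonneg _))
  rw [setLIntegral_countingMeasure _ hC.1.measurableSet (by fun_prop)] at hint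
  have hfin := ENNReal.finite_const_le_of_tsum_ne_top hint.ne one_ne_zero
  refine infinite_inter_of_mem_asymptoticCone hx0 hx hC hxC
    ((hfin.image fun w : G.language => letterCount (w : List A)).subset ?_)
  rintro _ ⟨hwC, w, hw, rfl⟩
  refine ⟨⟨w, hw⟩, ?_, rfl⟩
  simp only [Set.mem_ofPred_eq, Set.indicator_of_mem hwC, ENNReal.one_le_ofReal,
    Real.one_le_exp_iff]
  exact mul_nonneg (neg_nonneg.2 hs0) (norm_nonneg _)

/-- Some open cone around `x` contains the letter vectors of only finitely many words, so every real
exponent is integrable on it. -/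
theorem psi_eq_bot_of_notMem_cone {x : EuclideanSpace ℝ A} (hx : x ∉ G.cone) : G.psi x = ⊥ := by
  have hx0 : x ≠ 0 := by
    rintro rfl
    exact hx (zero_mem_asymptoticCone.2 ⟨_, [], List.isChain_nil, rfl⟩)
  obtain ⟨C, hC, hxC, hbdd⟩ := exists_isOpenCone_isBounded_inter hx
  obtain ⟨R, hR⟩ := hbdd.exists_norm_le
  rw [EReal.eq_bot_iff_forall_lt]
  intro c
  refine (growthIndicator_lt_coe_iff hx0).2 ⟨C, hC, hxC, (c - 1) / ‖x‖, ?_, ?_⟩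
  · rw [div_mul_cancel₀ _ (norm_ne_zero_iff.2 hx0)]
    linarith
  · rw [setLIntegral_countingMeasure _ hC.1.measurableSet (by fun_prop)]
    have hfin : {w : G.language | letterCount (w : List A) ∈ C}.Finite := by
      refine Set.Finite.of_finite_image ((finite_setOf_norm_letterCount_le R).subset ?_)
        Subtype.val_injective.injOn
      rintro _ ⟨w, hw, rfl⟩
      exact hR _ ⟨hw, w, w.2, rfl⟩
    rw [tsum_eq_sum (s := hfin.toFinset)]
    · refine ENNReal.sum_lt_top.2 fun w hw => ?_
      have hwC : letterCount (w : List A) ∈ C := hfin.mem_toFinset.1 hw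
      rw [Set.indicator_of_mem hwC]
      exact ENNReal.ofReal_lt_top
    · intro w hw
      have hwC : letterCount (w : List A) ∉ C := fun h => hw (hfin.mem_toFinset.2 h)
      exact Set.indicator_of_notMem hwC _

theorem essentialDomain_psi : essentialDomain G.psi = G.cone := by
  ext x
  refine ⟨fun hx => ?_, fun hx => EReal.bot_lt_zero.trans_le (G.zero_le_psi_of_mem_cone hx)⟩
  by_contra h
  exact (hx : ⊥ < G.psi x).ne' (G.psi_eq_bot_of_notMem_cone h)

theorem nonneg_of_mem_cone {x : EuclideanSpace ℝ A} (hx : x ∈ G.cone) (a : A) : 0 ≤ x a := by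
  obtain ⟨t, y, ht, hy, -, hlim⟩ := mem_asymptoticCone_iff_exists_seq.1 hx
  refine ge_of_tendsto' (((EuclideanSpace.proj (𝕜 := ℝ) a).continuous.tendsto x).comp hlim)
    fun n => ?_
  obtain ⟨w, -, hw⟩ := hy n
  simp only [Function.comp_apply, ← hw, PiLp.proj_apply, PiLp.smul_apply, smul_eq_mul,
    letterCount_apply]
  exact mul_nonneg (ht n) (Nat.cast_nonneg _)

omit [Fintype A] [DecidableEq A] in
theorem sum_map_nabla_of_isPath (f : Q → ℝ) :
    ∀ {q q' : Q} {w : List A}, G.IsPath q w q' →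
      (w.map fun a => f (G.target a) - f (G.source a)).sum = f q' - f q
  | q, q', [], h => by simp [show q = q' from h]
  | q, q', a :: w, ⟨h, h'⟩ => by
    rw [List.map_cons, List.sum_cons, sum_map_nabla_of_isPath f h', h]
    ring

omit [Fintype A] [DecidableEq A] in
theorem exists_isPath_of_mem_language [Nonempty Q] :
    ∀ {w : List A}, w ∈ G.language → ∃ q q', G.IsPath q w q' ∧ ∀ a ∈ w.head?, G.source a = q
  | [], _ => ⟨Classical.arbitrary Q, _, rfl, by simp⟩
  | [a], _ => ⟨_, _, ⟨rfl, rfl⟩, by simp⟩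
  | a :: b :: w, h => by
    obtain ⟨hab, hw⟩ := List.isChain_cons_cons.1 h
    obtain ⟨q, q', hp, hq⟩ := exists_isPath_of_mem_language hw
    refine ⟨G.source a, q', ⟨rfl, ?_⟩, by simp⟩
    rwa [hab, hq b (by simp)]

/-- Along a path, the pairing with `∇f` telescopes to a difference of two values of `f`. It stays
bounded, so the factors `t n → 0` kill it in the limit. -/
theorem cone_subset_nablaPerp [Fintype Q] :
    G.cone ⊆ (G.nablaPerp : Set (EuclideanSpace ℝ A)) := by
  intro x hx
  rcases isEmpty_or_nonempty Q with hQ | hQ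
  · have : IsEmpty A := ⟨fun a => hQ.elim (G.source a)⟩
    rw [SetLike.mem_coe, Subsingleton.elim x 0]
    exact G.nablaPerp.zero_mem
  rw [SetLike.mem_coe, mem_nablaPerp_iff]
  intro f
  obtain ⟨t, y, ht, hy, ht0, hlim⟩ := mem_asymptoticCone_iff_exists_seq.1 hx
  set φ := linearForm fun a => f (G.target a) - f (G.source a) with hφ
  have hlim' := (φ.continuous.tendsto x).comp hlim
  rw [← linearForm_apply, ← hφ]
  refine tendsto_nhds_unique hlim' ?_
  refine squeeze_zero_norm (a := fun n => t n * (2 * ∑ q, |f q|)) (fun n => ?_)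
    (by simpa using ht0.mul_const _)
  obtain ⟨w, hw, hwy⟩ := hy n
  obtain ⟨q, q', hp, -⟩ := G.exists_isPath_of_mem_language hw
  rw [Function.comp_apply, map_smul, norm_smul, Real.norm_of_nonneg (ht n), ← hwy, hφ,
    linearForm_letterCount, G.sum_map_nabla_of_isPath f hp]
  refine mul_le_mul_of_nonneg_left ((norm_sub_le _ _).trans ?_) (ht n)
  have h1 : ∀ q, ‖f q‖ ≤ ∑ q, |f q| := fun q =>
    single_le_sum (f := fun q => |f q|) (fun _ _ => abs_nonneg _) (mem_univ q)
  linarith [h1 q, h1 q']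

/-- Connectedness closes each arrow into a loop. The letter vector of a loop is a circulation, and
the sum over all arrows is positive everywhere. -/
theorem exists_pos_mem_nablaPerp (hG : G.Connected) :
    ∃ z ∈ G.nablaPerp, ∀ a, 0 < z a := by
  choose w hw using fun a => hG (G.target a) (G.source a)
  refine ⟨∑ a, letterCount (a :: w a), G.nablaPerp.sum_mem fun a _ => ?_, fun b => ?_⟩
  · rw [mem_nablaPerp_iff]
    intro f
    rw [← linearForm_apply, linearForm_letterCount,
      G.sum_map_nabla_of_isPath f (show G.IsPath (G.source a) (a :: w a) (G.source a) from ⟨rfl, hw a⟩), sub_self]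
  · rw [← PiLp.proj_apply (𝕜 := ℝ) (p := 2) (β := fun _ : A => ℝ) b, map_sum]
    refine sum_pos' (fun a _ => ?_) ⟨b, mem_univ b, ?_⟩
    · exact Nat.cast_nonneg _
    · exact Nat.cast_pos.2 (List.count_pos_iff.2 List.mem_cons_self)

variable {G}

theorem entropy_le_psi [Fintype Q] (hG : G.Connected) {x : EuclideanSpace ℝ A}
    (hx : ∀ a, 0 < x a) (hxG : x ∈ G.nablaPerp) : (G.entropy x : EReal) ≤ G.psi x := by
  classical
  -- Here `x = 0` has positive coordinates only because `A` is then empty.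
  rcases eq_or_ne x 0 with rfl | hx0
  · simp [psi, growthIndicator, entropy]
  obtain ⟨a₀, -⟩ : ∃ a, x a ≠ 0 := by
    by_contra! h0
    exact hx0 (by ext a; exact h0 a)
  have : Nonempty A := ⟨a₀⟩
  have : Nonempty Q := ⟨G.source a₀⟩
  -- Otherwise `L_x` would strictly dominate `psi` off the origin and the sum over the language
  -- would converge, whereas stochastic weights make it diverge.
  obtain ⟨y, hy0, hy⟩ : ∃ y, y ≠ 0 ∧ (linearForm (G.potential x) y : EReal) ≤ G.psi y := by
    by_contra! h
    refine (lintegral_exp_neg_lt_top_of_growthIndicator_lt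
      (countingMeasure_singleton_zero_lt_top G.language) (linearForm (G.potential x)) h).ne ?_
    rw [lintegral_countingMeasure _ (by fun_prop)]
    simp only [← prod_map_ofReal_exp_neg]
    refine G.tsum_language_eq_top fun q => ?_
    rw [← ENNReal.ofReal_sum_of_nonneg fun a _ => (Real.exp_pos _).le]
    convert ENNReal.ofReal_one
    convert G.sum_exp_neg_potential hx (exists_arrow hG q)
  have hyC : y ∈ G.cone := by
    by_contra h
    rw [G.psi_eq_bot_of_notMem_cone h] at hy
    exact (EReal.bot_lt_coe _).not_ge hy
  have hynn := G.nonneg_of_mem_cone hyC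
  by_cases hxy : ∃ t : ℝ, 0 < t ∧ y = t • x
  · obtain ⟨t, ht, rfl⟩ := hxy
    -- On the ray of `x`, the bound transfers from `t • x` to `x` since a cone and exponent that
    -- work for `x` also work for `t • x`.
    by_contra! h
    refine hy.not_gt ?_
    obtain ⟨C, hC, hxC, s, hs, hint⟩ := (growthIndicator_lt_coe_iff hx0).1 h
    refine (growthIndicator_lt_coe_iff hy0).2 ⟨C, hC, hC.2 x hxC t ht, s, ?_, hint⟩
    rw [norm_smul, Real.norm_of_nonneg ht.le, map_smul, smul_eq_mul]
    have := mul_lt_mul_of_pos_left hs ht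
    rw [entropy] at this
    linarith
  -- Off the ray, the stochastic weights of `x + y` bound `psi y` strictly below `L_x y`.
  · have h1 := linearForm_potential_add_lt hG hx hxG hy0 hynn (G.cone_subset_nablaPerp hyC) hxy
    have h2 := G.psi_le_linearForm (L := G.potential (x + y))
      (fun q => by
        convert G.sum_exp_neg_potential_le (x := x + y)
          (fun a => add_pos_of_pos_of_nonneg (hx a) (hynn a)) q) hy0
    exact absurd (EReal.coe_le_coe_iff.1 (hy.trans h2)) h1.not_ge

theorem psi_eq_entropy [Fintype Q] (hG : G.Connected) {x : EuclideanSpace ℝ A}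
    (hx : ∀ a, 0 < x a) (hxG : x ∈ G.nablaPerp) : G.psi x = G.entropy x := by
  classical
  refine le_antisymm ?_ (entropy_le_psi hG hx hxG)
  rcases eq_or_ne x 0 with rfl | hx0
  · simp [psi, growthIndicator, entropy]
  · exact G.psi_le_linearForm (fun q => by convert G.sum_exp_neg_potential_le hx q) hx0

theorem psi_lt_top [Fintype Q] (hG : G.Connected) (x : EuclideanSpace ℝ A) : G.psi x < ⊤ := by
  classical
  rcases eq_or_ne x 0 with rfl | hx0
  · simp [psi, growthIndicator]
  obtain ⟨z, -, hz⟩ := G.exists_pos_mem_nablaPerp hG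
  exact (G.psi_le_linearForm (L := G.potential z)
    (fun q => by convert G.sum_exp_neg_potential_le hz q) hx0).trans_lt (EReal.coe_lt_top _)

theorem mem_cone_of_pos [Fintype Q] (hG : G.Connected) {x : EuclideanSpace ℝ A}
    (hx : ∀ a, 0 < x a) (hxG : x ∈ G.nablaPerp) : x ∈ G.cone := by
  rw [← G.essentialDomain_psi]
  exact (EReal.bot_lt_coe _).trans_le (entropy_le_psi hG hx hxG)

theorem coneInterior_eq [Fintype Q] (hG : G.Connected) :
    G.coneInterior = {x : G.nablaPerp | ∀ a, 0 < (x : EuclideanSpace ℝ A) a} := by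
  apply subset_antisymm
  · intro x hx a
    obtain ⟨z, hzG, hz⟩ := G.exists_pos_mem_nablaPerp hG
    set z' : G.nablaPerp := ⟨z, hzG⟩
    -- An interior point can be moved slightly by `-t • z`, with `z` positive, and stay in the cone.
    -- Its coordinates are therefore at least `t * z a > 0`.
    have hcont : Tendsto (fun t : ℝ => x - t • z') (𝓝[>] 0) (𝓝 x) := by
      have : Continuous fun t : ℝ => x - t • z' := by fun_prop
      simpa using (this.tendsto 0).mono_left nhdsWithin_le_nhds
    obtain ⟨t, hC, ht⟩ :=
      ((hcont.eventually (mem_interior_iff_mem_nhds.1 hx)).and self_mem_nhdsWithin).exists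
    have h1 : 0 ≤ (x : EuclideanSpace ℝ A) a - t * z a := G.nonneg_of_mem_cone hC a
    linarith [mul_pos (Set.mem_Ioi.1 ht) (hz a)]
  · refine interior_maximal (fun x hx => mem_cone_of_pos hG hx x.2) ?_
    have : {x : G.nablaPerp | ∀ a, 0 < (x : EuclideanSpace ℝ A) a}
        = ⋂ a, {x : G.nablaPerp | 0 < (x : EuclideanSpace ℝ A) a} := by
      ext x
      simp
    rw [this]
    exact isOpen_iInter_of_finite fun a => isOpen_lt continuous_const (by fun_prop)

end DirectedGraph

/-! ### Transfer of the properties of the entropy to `psi`. -/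

theorem mainTheorem3 {Q A : Type*} [Fintype Q] [Fintype A] [DecidableEq A]
    (G : DirectedGraph Q A) (hG : G.Connected) :
    (∀ x, G.psi x < ⊤) ∧
    essentialDomain G.psi = G.cone ∧
    closure (essentialDomain G.psi) = G.cone ∧
    G.cone ⊆ (G.nablaPerp : Set (EuclideanSpace ℝ A)) ∧
    G.coneInterior.Nonempty ∧
    AnalyticOnNhd ℝ (fun x : G.nablaPerp => (G.psi x).toReal) G.coneInterior ∧
    HomogeneousStrictConcaveOn G.coneInterior (fun x : G.nablaPerp => (G.psi x).toReal) ∧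
    (Nonempty A → ¬ G.IsCyclic → ∀ x ∈ G.coneInterior, 0 < G.psi x) := by
  have hcone := DirectedGraph.coneInterior_eq hG
  have hopen : IsOpen G.coneInterior := isOpen_interior
  have hpsi : ∀ x ∈ G.coneInterior, (G.psi x).toReal = G.entropy x := by
    intro x hx
    rw [hcone] at hx
    rw [DirectedGraph.psi_eq_entropy hG hx x.2, EReal.toReal_coe]
  have hadd : ∀ x ∈ G.coneInterior, ∀ y ∈ G.coneInterior, x + y ∈ G.coneInterior := by
    rw [hcone]
    exact fun x hx y hy a => add_pos (hx a) (hy a)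
  have hsmul : ∀ x ∈ G.coneInterior, ∀ t : ℝ, 0 < t → t • x ∈ G.coneInterior := by
    rw [hcone]
    exact fun x hx t ht a => mul_pos ht (hx a)
  refine ⟨DirectedGraph.psi_lt_top hG, G.essentialDomain_psi, ?_, G.cone_subset_nablaPerp,
    ?_, ?_, ⟨⟨?_, ?_⟩, ?_⟩, ?_⟩
  · rw [G.essentialDomain_psi]
    exact isClosed_asymptoticCone.closure_eq
  · obtain ⟨z, hzG, hz⟩ := G.exists_pos_mem_nablaPerp hG
    exact ⟨⟨z, hzG⟩, by rw [hcone]; exact hz⟩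
  · refine AnalyticOnNhd.congr hopen (f := fun x : G.nablaPerp => G.entropy x) ?_
      fun x hx => (hpsi x hx).symm
    intro x hx
    rw [hcone] at hx
    exact (DirectedGraph.analyticOnNhd_entropy (G := G) (x : EuclideanSpace ℝ A) hx).fun_comp (G.nablaPerp.subtypeL.analyticAt x)
  · refine convex_iff_forall_pos.2 fun x hx y hy a b ha hb _ => ?_
    exact hadd _ (hsmul x hx a ha) _ (hsmul y hy b hb)
  · intro x hx y hy a b ha hb hab
    -- Zero coefficients are treated apart: only positive multiples are known to stay in the open
    -- cone.
    rcases ha.eq_or_lt with rfl | ha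
    · simp [show b = 1 by linarith]
    rcases hb.eq_or_lt with rfl | hb
    · simp [show a = 1 by linarith]
    have hax := hsmul x hx a ha
    have hby := hsmul y hy b hb
    simp only [hpsi _ (hadd _ hax _ hby), hpsi x hx, hpsi y hy, smul_eq_mul]
    rw [hcone] at hx hy hax hby
    rw [← G.entropy_smul hx ha, ← G.entropy_smul hy hb]
    exact DirectedGraph.entropy_add_le hax hby
  · intro x hx y hy hxy
    simp only [hpsi _ (hadd _ hx _ hy), hpsi x hx, hpsi y hy]
    rw [hcone] at hx hy
    refine DirectedGraph.entropy_add_lt hG hx hy x.2 y.2 ?_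
    rintro ⟨t, ht, h⟩
    exact hxy ⟨t, ht, Subtype.ext h⟩
  · intro hA hcyc x hx
    rw [hcone] at hx
    rw [DirectedGraph.psi_eq_entropy hG hx x.2]
    exact EReal.coe_pos.2 (DirectedGraph.entropy_pos hG hcyc hx)
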